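/- Let $H:\mathbf{Set}\to\mathbf{Set}$ be a functor. **Definitions.** An $H$-algebra $a:HA\to A$ is *corecursive* if for every coalgebra $e:X\to HX$ there is a unique $e^\dagger:X\to A$ with $e^\dagger=a\cdot He^\dagger\cdot e$. Corecursive algebras form a full subcategory $\mathsf{Alg}_C H$ of the category of $H$-algebras, and $H$ *has free corecursive algebras* if the forgetful functor $\mathsf{Alg}_C H\to\mathbf{Set}$ has a left adjoint. In this case $\mathbb M=(M,\eta,\mu)$ denotes the monad of this adjunction, and $\delta_Y:HMY\to MY$ the structure of the free corecursive algebra on $Y$; $\mathbb M$ is regarded as an ideal monad (see below) with ideal $\delta:HM\to M$ and $\mu'=H\mu:HMM\to HM$. An *ideal monad* $\mathbb S=(S,\eta,\mu,S',\sigma,\mu')$ is a monad $(S,\eta,\mu)$ together with a subfunctor $\sigma:S'\to S$ such that $S=S'+\mathrm{Id}$ with injections $\sigma$ and $\eta$, and a natural transformation $\mu':S'S\to S'$ with $\sigma\cdot\mu'=\mu\cdot\sigma S$. It is *corecursive* if for every $e:X\to SX$ that factorizes through $\sigma_X$ and every $Y$ there is a unique $e^\dagger:X\to SY$ with $e^\dagger=\mu_Y\cdot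 Se^\dagger\cdot e$. An *ideal monad morphism* from $\mathbb S$ to $\mathbb U=(U,\eta^U,\mu^U,U',\omega,\mu'^U)$ is a pair of a monad morphism $\lambda:S\to U$ and a natural transformation $\lambda':S'\to U'$ with $\lambda\cdot\sigma=\omega\cdot\lambda'$. A natural transformation $H\to S$ is *ideal* if it factors through $\sigma$. A *free corecursive monad* on $H$ is a corecursive monad $\mathbb S$ with an ideal natural transformation $\kappa:H\to S$ such that for every corecursive monad $\mathbb U$ and every ideal natural transformation $\lambda:H\to U$ there is a unique ideal monad morphism $(\hat\lambda,\hat\lambda'):\mathbb S\to\mathbb U$ with $\hat\lambda\cdot\kappa=\lambda$. **Proposition.** If $H$ has a free corecursive monad $(\mathbb S,\kappa)$, then $H$ has free corecursive algebras. Hence the free corecursive monad on $H$ is the monad $\mathbb M$ of free corecursive algebras: $\mathbb M$ with $\delta\cdot H\eta:H\to M$ is a free corecursive monad on $H$, and there is an isomorphism $i:\mathbb S\to\mathbb M$ of ideal monads with $i\cdot\kappa=\delta\cdot H\eta$. -/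

import Mathlib

open CategoryTheory CategoryTheory.Limits

attribute [local instance 2000] CategoryStruct.toQuiver

namespace CorecursiveMonads

universe v u

/-! ### Corecursive algebras -/

section Algebras

variable {C : Type u} [Category.{v} C] (H : C ⥤ C)

/-- `f : X ⟶ A` is a coalgebra-to-algebra morphism from `e : X ⟶ H X` to `a : H A ⟶ A`,
that is, `f = a · H f · e` (a solution of `e` in the algebra). -/
def IsSolution {H : C ⥤ C} (E : Endofunctor.Coalgebra H) (A : Endofunctor.Algebra H)
    (f : E.V ⟶ A.a) : Prop :=
  f = E.str ≫ H.map f ≫ A.str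

/-- An `H`-algebra is corecursive if every `H`-coalgebra has a unique
coalgebra-to-algebra morphism into it. -/
def IsCorecursiveAlgebra : ObjectProperty (Endofunctor.Algebra H) :=
  fun A => ∀ E : Endofunctor.Coalgebra H, ∃! f : E.V ⟶ A.a, IsSolution E A f

/-- The category of corecursive algebras, a full subcategory of the category of `H`-algebras. -/
abbrev CorecursiveAlgebra := (IsCorecursiveAlgebra H).FullSubcategory

/-- The forgetful functor from corecursive algebras to the base category. -/
abbrev forgetCorecursive : CorecursiveAlgebra H ⥤ C :=
  (IsCorecursiveAlgebra H).ι ⋙ Endofunctor.Algebra.forget H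

/-- `H` has free corecursive algebras: the forgetful functor has a left adjoint. -/
def HasFreeCorecursiveAlgebras : Prop :=
  (forgetCorecursive H).IsRightAdjoint

end Algebras

/-! ### Ideal monads and corecursive monads -/

section Monads

/-- An ideal monad `(S, η, μ, S', σ, μ')`: a monad `S` with a subfunctor `σ : S' ⟶ S` such that
`S = S' + Id` with injections `σ` and `η`, and with `μ' : S'S ⟶ S'` restricting `μ`. -/
structure IdealMonad (C : Type u) [Category.{v} C] extends Monad C where
  /-- the ideal `S'` -/
  ideal : C ⥤ C
  /-- the inclusion of the ideal -/
  σ : ideal ⟶ toFunctor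
  /-- the restricted multiplication -/
  μ' : toFunctor ⋙ ideal ⟶ ideal
  mono_σ : ∀ Y : C, Mono (σ.app Y)
  isCoproduct : ∀ Y : C, Nonempty (IsColimit (BinaryCofan.mk (σ.app Y) (η.app Y)))
  μ'_σ : ∀ Y : C, μ'.app Y ≫ σ.app Y = σ.app (toFunctor.obj Y) ≫ μ.app Y

variable {C : Type u} [Category.{v} C]

namespace IdealMonad

/-- An ideal monad morphism: a monad morphism `l : S ⟶ U` together with a natural transformation
`l' : S' ⟶ U'` with `l · σ = ω · l'`. -/
@[ext]
structure Hom (S U : IdealMonad C) where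
  /-- the monad morphism -/
  l : S.toMonad ⟶ U.toMonad
  /-- the natural transformation between the ideals -/
  l' : S.ideal ⟶ U.ideal
  comm : S.σ ≫ l.toNatTrans = l' ≫ U.σ

instance : Category (IdealMonad C) where
  Hom S U := Hom S U
  id S :=
    { l := 𝟙 S.toMonad
      l' := 𝟙 S.ideal
      comm := by ext Y; simp }
  comp {S U V} f g :=
    { l := f.l ≫ g.l
      l' := f.l' ≫ g.l'
      comm := by
        ext Y
        have h₁ := NatTrans.congr_app f.comm Y
        have h₂ := NatTrans.congr_app g.comm Y
        simp only [NatTrans.comp_app] at h₁ h₂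
        simp only [NatTrans.comp_app, MonadHom.comp_toNatTrans, Category.assoc]
        rw [reassoc_of% h₁, h₂] }
  id_comp f := Hom.ext (Category.id_comp _) (Category.id_comp _)
  comp_id f := Hom.ext (Category.comp_id _) (Category.comp_id _)
  assoc f g h := Hom.ext (Category.assoc _ _ _) (Category.assoc _ _ _)

/-- The natural transformation `S ⟶ U` underlying an ideal monad morphism. -/
abbrev natTrans {S U : IdealMonad C} (f : S ⟶ U) : S.toFunctor ⟶ U.toFunctor :=
  (Hom.l f).toNatTrans

variable (S : IdealMonad C)

/-- An equation morphism `e : X ⟶ S X` is ideal if it factorizes through `σ_X`. -/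
def IsIdealEquation {X : C} (e : X ⟶ S.obj X) : Prop :=
  ∃ e₀ : X ⟶ S.ideal.obj X, e₀ ≫ S.σ.app X = e

/-- `s : X ⟶ S Y` is a solution of the equation morphism `e : X ⟶ S X`,
that is, `s = μ_Y · S s · e`. -/
def IsEquationSolution {X : C} (e : X ⟶ S.obj X) {Y : C} (s : X ⟶ S.obj Y) : Prop :=
  s = e ≫ S.map s ≫ S.μ.app Y

/-- An ideal monad is corecursive if every ideal equation morphism `e : X ⟶ S X` has, for every
object `Y`, a unique solution `X ⟶ S Y`. -/
def IsCorecursive : Prop :=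
  ∀ (X : C) (e : X ⟶ S.obj X), S.IsIdealEquation e →
    ∀ Y : C, ∃! s : X ⟶ S.obj Y, S.IsEquationSolution e s

/-- A natural transformation `H ⟶ S` is ideal if it factors through `σ : S' ⟶ S`. -/
def IsIdealTransformation {H : C ⥤ C} (S : IdealMonad C) (lam : H ⟶ S.toFunctor) : Prop :=
  ∃ lam' : H ⟶ S.ideal, lam' ≫ S.σ = lam

/-- `S` together with `κ : H ⟶ S` is a free corecursive monad on `H`. -/
structure IsFreeCorecursiveMonad (H : C ⥤ C) (S : IdealMonad C) (κ : H ⟶ S.toFunctor) : Prop where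
  isCorecursive : S.IsCorecursive
  isIdeal : S.IsIdealTransformation κ
  universal : ∀ (U : IdealMonad C), U.IsCorecursive →
    ∀ lam : H ⟶ U.toFunctor, U.IsIdealTransformation lam →
      ∃! f : S ⟶ U, κ ≫ natTrans f = lam

end IdealMonad

end Monads

/-! ### The monad of free corecursive algebras -/

section FreeAlgebraMonad

variable {C : Type u} [Category.{v} C] {H : C ⥤ C} {F : C ⥤ CorecursiveAlgebra H}

/-- The natural transformation `δ : HM ⟶ M` given by the structures of the free corecursive
algebras `M Y`, where `M` is the monad of the adjunction. -/
def freeStr (adj : F ⊣ forgetCorecursive H) : adj.toMonad.toFunctor ⋙ H ⟶ adj.toMonad.toFunctor where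
  app Y := (F.obj Y).obj.str
  naturality _ _ f := (F.map f).hom.h

/-- The algebra `inl · H[a, f]` on `H A + B`, for an algebra `(A, a)` and `f : B ⟶ A`. -/
noncomputable def coprodAlgebra [HasBinaryCoproducts C] (A : Endofunctor.Algebra H) {B : C}
    (f : B ⟶ A.a) : Endofunctor.Algebra H where
  a := H.obj A.a ⨿ B
  str := H.map (coprod.desc A.str f) ≫ coprod.inl

theorem isCorecursiveAlgebra_coprod [HasBinaryCoproducts C] {A : Endofunctor.Algebra H}
    (hA : IsCorecursiveAlgebra H A) {B : C} (f : B ⟶ A.a) :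
    IsCorecursiveAlgebra H (coprodAlgebra A f) := by
  intro E
  obtain ⟨s, hs, hu⟩ := hA E
  dsimp only [IsSolution] at hs hu
  have hd : (coprod.inl : _ ⟶ H.obj A.a ⨿ B) ≫ coprod.desc A.str f = A.str :=
    coprod.inl_desc _ _
  refine ⟨E.str ≫ H.map s ≫ (coprod.inl : _ ⟶ H.obj A.a ⨿ B), ?_, ?_⟩
  · change E.str ≫ H.map s ≫ (coprod.inl : _ ⟶ H.obj A.a ⨿ B) =
      E.str ≫ H.map (E.str ≫ H.map s ≫ (coprod.inl : _ ⟶ H.obj A.a ⨿ B)) ≫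
        H.map (coprod.desc A.str f) ≫ coprod.inl
    rw [← H.map_comp_assoc, Category.assoc, Category.assoc, hd, ← hs]
  · intro (t : E.V ⟶ H.obj A.a ⨿ B) ht
    replace ht : t = E.str ≫ H.map t ≫ H.map (coprod.desc A.str f) ≫ coprod.inl := ht
    have key : t ≫ coprod.desc A.str f = s := by
      apply hu
      conv_lhs => rw [ht]
      simp only [Category.assoc, H.map_comp, hd]
    rw [← H.map_comp_assoc, key] at ht
    exact ht

theorem nonempty_isColimit_of_retraction [HasBinaryCoproducts C] {X Y A : C}
    (a : X ⟶ A) (u : Y ⟶ A) (g : A ⟶ X ⨿ Y) (ha : a ≫ g = coprod.inl) (hu : u ≫ g = coprod.inr)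
    (hg : g ≫ coprod.desc a u = 𝟙 A) : Nonempty (IsColimit (BinaryCofan.mk a u)) :=
  ⟨BinaryCofan.IsColimit.mk _ (fun {T} (p : X ⟶ T) (q : Y ⟶ T) => g ≫ coprod.desc p q)
    (fun {T} (p : X ⟶ T) (q : Y ⟶ T) => by
      change a ≫ g ≫ coprod.desc p q = p
      rw [reassoc_of% ha, coprod.inl_desc])
    (fun {T} (p : X ⟶ T) (q : Y ⟶ T) => by
      change u ≫ g ≫ coprod.desc p q = q
      rw [reassoc_of% hu, coprod.inr_desc])
    (fun {T} (p : X ⟶ T) (q : Y ⟶ T) (m : A ⟶ T) h₁ h₂ => by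
      replace h₁ : a ≫ m = p := h₁
      replace h₂ : u ≫ m = q := h₂
      change m = g ≫ coprod.desc p q
      rw [← h₁, ← h₂, ← coprod.desc_comp, reassoc_of% hg])⟩

/-- The monad `M` of free corecursive algebras is the coproduct of `HM` and the identity. -/
theorem free_isCoproduct [HasBinaryCoproducts C] (adj : F ⊣ forgetCorecursive H) (Y : C) :
    Nonempty (IsColimit
      (BinaryCofan.mk ((freeStr adj).app Y) (adj.toMonad.η.app Y))) := by
  let A : Endofunctor.Algebra H := (F.obj Y).obj
  let u : Y ⟶ A.a := adj.unit.app Y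
  let B : CorecursiveAlgebra H :=
    ⟨coprodAlgebra A u, isCorecursiveAlgebra_coprod (F.obj Y).property u⟩
  let k : F.obj Y ⟶ B := (adj.homEquiv Y B).symm (coprod.inr : Y ⟶ H.obj A.a ⨿ Y)
  let g : A.a ⟶ H.obj A.a ⨿ Y := k.hom.f
  have hg : u ≫ g = coprod.inr := by
    have := (adj.homEquiv Y B).apply_symm_apply (coprod.inr : Y ⟶ H.obj A.a ⨿ Y)
    rw [adj.homEquiv_unit] at this
    exact this
  have hk : H.map g ≫ H.map (coprod.desc A.str u) ≫ coprod.inl = A.str ≫ g := k.hom.h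
  have hinl : (coprod.inl : _ ⟶ H.obj A.a ⨿ Y) ≫ coprod.desc A.str u = A.str :=
    coprod.inl_desc _ _
  have hinr : (coprod.inr : _ ⟶ H.obj A.a ⨿ Y) ≫ coprod.desc A.str u = u :=
    coprod.inr_desc _ _
  let d : B ⟶ F.obj Y := ObjectProperty.homMk
    { f := coprod.desc A.str u
      h := by
        change H.map (coprod.desc A.str u) ≫ A.str =
          (H.map (coprod.desc A.str u) ≫ coprod.inl) ≫ coprod.desc A.str u
        rw [Category.assoc, hinl] }
  have hkd : k ≫ d = 𝟙 _ := by
    apply (adj.homEquiv _ _).injective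
    rw [adj.homEquiv_unit, adj.homEquiv_unit]
    change u ≫ g ≫ coprod.desc A.str u = u ≫ 𝟙 A.a
    rw [reassoc_of% hg, hinr, Category.comp_id]
  have hgd : g ≫ coprod.desc A.str u = 𝟙 A.a :=
    congrArg (fun k : F.obj Y ⟶ F.obj Y => k.hom.f) hkd
  refine nonempty_isColimit_of_retraction A.str u g ?_ hg hgd
  rw [← hk, ← H.map_comp_assoc, hgd, H.map_id, Category.id_comp]

/-- The monad `M` of free corecursive algebras as an ideal monad, with ideal `M' = HM`,
`σ = δ : HM ⟶ M` and `μ' = Hμ : HMM ⟶ HM`. -/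
def freeIdealMonad [HasBinaryCoproducts C] [MonoCoprod C] (adj : F ⊣ forgetCorecursive H) :
    IdealMonad C where
  toMonad := adj.toMonad
  ideal := adj.toMonad.toFunctor ⋙ H
  σ := freeStr adj
  μ' := Functor.whiskerRight adj.toMonad.μ H
  mono_σ Y := MonoCoprod.binaryCofan_inl _ (free_isCoproduct adj Y).some
  isCoproduct Y := free_isCoproduct adj Y
  μ'_σ Y := (adj.counit.app (F.obj Y)).hom.h

/-- The natural transformation `κ = δ · Hη : H ⟶ M`. -/
def freeUnit [HasBinaryCoproducts C] [MonoCoprod C] (adj : F ⊣ forgetCorecursive H) :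
    H ⟶ (freeIdealMonad adj).toFunctor :=
  Functor.whiskerRight adj.toMonad.η H ≫ freeStr adj

end FreeAlgebraMonad

end CorecursiveMonads

universe w

/-!
Write `c : HS ⟶ S` for the composite `μ · κS`, called the action of `κ`. For a corecursive monad `S`
and an ideal transformation `κ`, a coalgebra `e : X ⟶ H X` has the same solutions in the `H`-algebra
`(S Y, c)` as the ideal equation morphism `κ · e` has in the monad; hence `(S Y, c)` is a
corecursive algebra (`IdealMonad.isCorecursiveAlgebra_action`).

If free corecursive algebras exist, then the unique homomorphisms `M Y ⟶ U Y` extending the unit of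
a corecursive monad `U` form a morphism of ideal monads, so the monad `M` of free corecursive
algebras is a free corecursive monad (`free_isFreeCorecursiveMonad`), and it is isomorphic to any
other one by universality (`IdealMonad.IsFreeCorecursiveMonad.exists_iso`).

The existence of free corecursive algebras has two ingredients.

* `HS + Id` is again a corecursive monad, and `[c, η] : HS + Id ⟶ S` is a morphism of ideal monads.
  If `S` is free, then `κ` lifts to `HS + Id`, and the induced morphism `S ⟶ HS + Id` is inverse to
  `[c, η]`. Thus `S Y` is the coproduct of `H S Y` and `Y`
  (`IdealMonad.IsFreeCorecursiveMonad.isCoproduct_action`). In particular `S ∅` is a corecursive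
  algebra with invertible structure, that is, the terminal coalgebra.

* The subalgebra `N` of `S Y` generated by `Y` and the image of `S ∅` is a free corecursive algebra
  on `Y` (`hasInitial_structuredArrow`). It is corecursive because solutions in `S Y` factor through
  the terminal coalgebra. A homomorphism from `N` to a corecursive algebra `A` is determined by its
  restriction to `Y`, because it is determined on the image of `S ∅`. It exists because `S Y × A`
  has a subalgebra that contains the graphs of the prescribed values on `Y` and on `S ∅` and whose
  projection to `S Y` is injective. This subalgebra is found by Zorn's lemma, as a maximal set with
  injective projection all of whose elements are generated, in one step, from `Y` or from the set
  itself (`exists_subalgebra_injOn`); the injectivity of `[c, η]` propagates the injectivity of the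
  projection.
-/

namespace CorecursiveMonads

universe v u

/-! ### The algebras `U Y` of a corecursive monad -/

namespace IdealMonad

variable {C : Type u} [Category.{v} C] {H : C ⥤ C}

/-- The action `μ · λU : HU ⟶ U` induced on a monad `U` by a natural transformation
`λ : H ⟶ U`. -/
def action (U : IdealMonad C) (lam : H ⟶ U.toFunctor) : U.toFunctor ⋙ H ⟶ U.toFunctor :=
  Functor.whiskerLeft U.toFunctor lam ≫ U.μ

section Action

variable (U : IdealMonad C) (lam : H ⟶ U.toFunctor)

theorem action_app (Y : C) : (U.action lam).app Y = lam.app (U.obj Y) ≫ U.μ.app Y := rfl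

theorem action_naturality {Y Z : C} (g : Y ⟶ Z) :
    H.map (U.map g) ≫ (U.action lam).app Z = (U.action lam).app Y ≫ U.map g :=
  (U.action lam).naturality g

theorem action_mu (Y : C) :
    H.map (U.μ.app Y) ≫ (U.action lam).app Y = (U.action lam).app (U.obj Y) ≫ U.μ.app Y := by
  have h := lam.naturality (U.μ.app Y)
  dsimp only [Functor.comp_obj] at h
  rw [action_app, action_app, reassoc_of% h, U.assoc, Category.assoc]

theorem eta_action (Y : C) : H.map (U.η.app Y) ≫ (U.action lam).app Y = lam.app Y := by
  have h := lam.naturality (U.η.app Y)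
  have h' : U.map (U.η.app Y) ≫ U.μ.app Y = 𝟙 (U.obj Y) := U.right_unit Y
  dsimp only [Functor.id_obj] at h h' ⊢
  rw [action_app, reassoc_of% h, h', Category.comp_id]

theorem action_eq_comp_σ {lam' : H ⟶ U.ideal} (h : lam' ≫ U.σ = lam) (Y : C) :
    (U.action lam).app Y = (lam'.app (U.obj Y) ≫ U.μ'.app Y) ≫ U.σ.app Y := by
  rw [action_app, ← h, Category.assoc, U.μ'_σ, NatTrans.comp_app, Category.assoc]

/-- Monad morphisms commute with the induced actions. -/
theorem action_comp_app {S : IdealMonad C} (κ : H ⟶ S.toFunctor)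
    (f : S.toMonad ⟶ U.toMonad) (hf : κ ≫ f.toNatTrans = lam) (Y : C) :
    (S.action κ).app Y ≫ f.app Y = H.map (f.app Y) ≫ (U.action lam).app Y := by
  subst hf
  have h := κ.naturality (f.app Y)
  rw [action_app, action_app, Category.assoc, MonadHom.app_μ, NatTrans.comp_app, Category.assoc,
    ← reassoc_of% h, Category.assoc]

/-- The `H`-algebra `U Y` given by the action of a natural transformation `H ⟶ U`. -/
def actionAlgebra (Y : C) : Endofunctor.Algebra H where
  a := U.obj Y
  str := (U.action lam).app Y

/-- The Kleisli extension of `k : Y ⟶ U Z` as a homomorphism of `H`-algebras. -/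
def extendHom {Y Z : C} (k : Y ⟶ U.obj Z) : U.actionAlgebra lam Y ⟶ U.actionAlgebra lam Z where
  f := U.map k ≫ U.μ.app Z
  h := by
    change H.map (U.map k ≫ U.μ.app Z) ≫ (U.action lam).app Z =
      (U.action lam).app Y ≫ U.map k ≫ U.μ.app Z
    rw [H.map_comp, Category.assoc, action_mu, reassoc_of% (U.action_naturality lam k)]

/-- Solutions of a coalgebra `e : X ⟶ H X` in `U Y` are the solutions of the ideal equation
morphism `λ_X · e`. -/
theorem isCorecursiveAlgebra_action (hU : U.IsCorecursive) (hlam : U.IsIdealTransformation lam)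
    (Y : C) : IsCorecursiveAlgebra H (U.actionAlgebra lam Y) := by
  intro E
  obtain ⟨lam', hlam'⟩ := hlam
  have h₁ : U.IsIdealEquation (E.str ≫ lam.app E.V) :=
    ⟨E.str ≫ lam'.app E.V, by rw [← hlam', Category.assoc, NatTrans.comp_app]⟩
  have h₂ : ∀ s : E.V ⟶ U.obj Y, U.IsEquationSolution (E.str ≫ lam.app E.V) s ↔
      IsSolution E (U.actionAlgebra lam Y) s := by
    intro s
    have h := lam.naturality s
    change s = (E.str ≫ lam.app E.V) ≫ U.map s ≫ U.μ.app Y ↔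
      s = E.str ≫ H.map s ≫ (U.action lam).app Y
    rw [action_app, reassoc_of% h, Category.assoc]
  obtain ⟨s, hs, hu⟩ := hU _ _ h₁ Y
  exact ⟨s, (h₂ s).1 hs, fun t ht => hu t ((h₂ t).2 ht)⟩

end Action

end IdealMonad

/-! ### The monad of free corecursive algebras is a free corecursive monad -/

section FreeAlgebraMonad

variable {C : Type u} [Category.{v} C] {H : C ⥤ C} {F : C ⥤ CorecursiveAlgebra H}

theorem exists_free_hom (adj : F ⊣ forgetCorecursive H) {A : Endofunctor.Algebra H}
    (hA : IsCorecursiveAlgebra H A) {Y : C} (f : Y ⟶ A.a) :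
    ∃ p : adj.toMonad.obj Y ⟶ A.a,
      H.map p ≫ A.str = (freeStr adj).app Y ≫ p ∧ adj.toMonad.η.app Y ≫ p = f := by
  refine ⟨((adj.homEquiv Y ⟨A, hA⟩).symm f).hom.f, ((adj.homEquiv Y ⟨A, hA⟩).symm f).hom.h, ?_⟩
  have := (adj.homEquiv Y ⟨A, hA⟩).apply_symm_apply f
  rw [adj.homEquiv_unit] at this
  exact this

theorem free_hom_ext (adj : F ⊣ forgetCorecursive H) {A : Endofunctor.Algebra H}
    (hA : IsCorecursiveAlgebra H A) {Y : C} {p q : adj.toMonad.obj Y ⟶ A.a}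
    (hp : H.map p ≫ A.str = (freeStr adj).app Y ≫ p)
    (hq : H.map q ≫ A.str = (freeStr adj).app Y ≫ q)
    (h : adj.toMonad.η.app Y ≫ p = adj.toMonad.η.app Y ≫ q) : p = q := by
  let p' : F.obj Y ⟶ ⟨A, hA⟩ := ObjectProperty.homMk { f := p, h := hp }
  let q' : F.obj Y ⟶ ⟨A, hA⟩ := ObjectProperty.homMk { f := q, h := hq }
  have : p' = q' := by
    apply (adj.homEquiv _ _).injective
    rw [adj.homEquiv_unit, adj.homEquiv_unit]
    exact h
  exact congrArg (fun k : F.obj Y ⟶ ⟨A, hA⟩ => k.hom.f) this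

/-- A free corecursive monad is unique up to isomorphism. -/
theorem IdealMonad.IsFreeCorecursiveMonad.exists_iso {S U : IdealMonad C} {κ : H ⟶ S.toFunctor}
    {lam : H ⟶ U.toFunctor} (hS : IdealMonad.IsFreeCorecursiveMonad H S κ)
    (hU : IdealMonad.IsFreeCorecursiveMonad H U lam) :
    ∃ i : S ≅ U, κ ≫ IdealMonad.natTrans i.hom = lam := by
  obtain ⟨f, hf, -⟩ := hS.universal U hU.isCorecursive lam hU.isIdeal
  obtain ⟨g, hg, -⟩ := hU.universal S hS.isCorecursive κ hS.isIdeal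
  refine ⟨⟨f, g, ?_, ?_⟩, hf⟩
  · refine (hS.universal S hS.isCorecursive κ hS.isIdeal).unique ?_ (Category.comp_id κ)
    change κ ≫ IdealMonad.natTrans f ≫ IdealMonad.natTrans g = κ
    rw [reassoc_of% hf, hg]
  · refine (hU.universal U hU.isCorecursive lam hU.isIdeal).unique ?_ (Category.comp_id lam)
    change lam ≫ IdealMonad.natTrans g ≫ IdealMonad.natTrans f = lam
    rw [reassoc_of% hg, hf]

variable [HasBinaryCoproducts C] [MonoCoprod C]

theorem action_freeUnit (adj : F ⊣ forgetCorecursive H) :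
    (freeIdealMonad adj).action (freeUnit adj) = freeStr adj := by
  ext Y
  have h : H.map (adj.toMonad.μ.app Y) ≫ (freeStr adj).app Y =
    (freeStr adj).app (adj.toMonad.obj Y) ≫ adj.toMonad.μ.app Y := (freeIdealMonad adj).μ'_σ Y
  change (H.map (adj.toMonad.η.app (adj.toMonad.obj Y)) ≫ (freeStr adj).app (adj.toMonad.obj Y)) ≫
    adj.toMonad.μ.app Y = _
  rw [Category.assoc, ← h, ← H.map_comp_assoc, adj.toMonad.left_unit, H.map_id, Category.id_comp]

/-- An ideal equation morphism `X ⟶ HMX ⟶ MX` is extended by the identity of `HMX` to a coalgebra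
on `MX = HMX + X`. The solutions of this coalgebra in `MY` are the homomorphisms `MX ⟶ MY` whose
restriction to `X` solves the equation. -/
theorem free_isCorecursive (adj : F ⊣ forgetCorecursive H) :
    (freeIdealMonad adj).IsCorecursive := by
  let M := adj.toMonad
  let η : ∀ Y, Y ⟶ M.obj Y := fun Y => M.η.app Y
  let μ : ∀ Y, M.obj (M.obj Y) ⟶ M.obj Y := fun Y => M.μ.app Y
  let δ : ∀ Y, H.obj (M.obj Y) ⟶ M.obj Y := fun Y => (freeStr adj).app Y
  have hη : ∀ {Y Z : C} (g : Y ⟶ Z), g ≫ η Z = η Y ≫ M.map g := fun g => M.η.naturality g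
  have hδ : ∀ {Y Z : C} (g : Y ⟶ Z), H.map (M.map g) ≫ δ Z = δ Y ≫ M.map g :=
    fun g => (freeStr adj).naturality g
  have hμ : ∀ Y, H.map (μ Y) ≫ δ Y = δ (M.obj Y) ≫ μ Y := (freeIdealMonad adj).μ'_σ
  have hημ : ∀ Y, η (M.obj Y) ≫ μ Y = 𝟙 (M.obj Y) := M.left_unit
  intro X (e : X ⟶ M.obj X) he Y
  obtain ⟨e₀, he⟩ : ∃ e₀ : X ⟶ H.obj (M.obj X), e₀ ≫ δ X = e := he
  obtain ⟨hX⟩ := free_isCoproduct adj X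
  -- the coalgebra `d = [id, e₀]` on `M X = H M X + X`
  obtain ⟨d, hd₁, hd₂⟩ : ∃ d : M.obj X ⟶ H.obj (M.obj X), δ X ≫ d = 𝟙 _ ∧ η X ≫ d = e₀ :=
    let d := BinaryCofan.IsColimit.desc' hX (𝟙 (H.obj (M.obj X))) e₀
    ⟨d.1, d.2.1, d.2.2⟩
  have hηM : ∀ s : X ⟶ M.obj Y, η X ≫ M.map s ≫ μ Y = s := by
    intro s
    rw [← reassoc_of% (hη s), hημ, Category.comp_id]
  have hδM : ∀ s : X ⟶ M.obj Y,
      H.map (M.map s ≫ μ Y) ≫ δ Y = δ X ≫ M.map s ≫ μ Y := by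
    intro s
    rw [H.map_comp, Category.assoc, hμ, reassoc_of% (hδ s)]
  have hsol : ∀ s : X ⟶ M.obj Y, s = e ≫ M.map s ≫ μ Y ↔
      s = e₀ ≫ H.map (M.map s ≫ μ Y) ≫ δ Y := by
    intro s
    rw [← he, hδM, Category.assoc]
  obtain ⟨t, ht, hu⟩ : ∃! t : M.obj X ⟶ M.obj Y, t = d ≫ H.map t ≫ δ Y :=
    (F.obj Y).property ⟨M.obj X, d⟩
  have ht' : H.map t ≫ δ Y = δ X ≫ t := by
    conv_rhs => rw [ht]
    rw [reassoc_of% hd₁]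
  change ∃! s : X ⟶ M.obj Y, s = e ≫ M.map s ≫ μ Y
  refine ⟨η X ≫ t, (hsol _).2 ?_, fun s hs => ?_⟩
  · have h : M.map (η X ≫ t) ≫ μ Y = t :=
      free_hom_ext adj (F.obj Y).property (hδM _) ht' (hηM _)
    rw [h]
    conv_lhs => rw [ht]
    rw [reassoc_of% hd₂]
  · replace hs := (hsol s).1 hs
    have h : M.map s ≫ μ Y = t := by
      apply hu
      apply BinaryCofan.IsColimit.hom_ext hX
      · change δ X ≫ _ = δ X ≫ d ≫ _
        rw [reassoc_of% hd₁, hδM]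
      · change η X ≫ _ = η X ≫ d ≫ _
        rw [reassoc_of% hd₂, ← hs, hηM]
    rw [← h, hηM]

/-- The morphism `M ⟶ U` induced by an ideal transformation `H ⟶ U` consists of the unique
homomorphisms `MY ⟶ UY` of `H`-algebras extending the unit of `U`. -/
theorem free_isFreeCorecursiveMonad (adj : F ⊣ forgetCorecursive H) :
    IdealMonad.IsFreeCorecursiveMonad H (freeIdealMonad adj) (freeUnit adj) := by
  refine ⟨free_isCorecursive adj, ⟨Functor.whiskerRight adj.toMonad.η H, rfl⟩, ?_⟩
  intro U hU lam hlam
  let M := adj.toMonad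
  let δ := freeStr adj
  let c := U.action lam
  have hc : ∀ Y, IsCorecursiveAlgebra H (U.actionAlgebra lam Y) :=
    U.isCorecursiveAlgebra_action lam hU hlam
  have ex : ∀ Y, ∃ p : M.obj Y ⟶ U.obj Y,
      H.map p ≫ c.app Y = δ.app Y ≫ p ∧ M.η.app Y ≫ p = U.η.app Y :=
    fun Y => exists_free_hom adj (hc Y) (U.η.app Y)
  have ext : ∀ {Y Z : C} {p q : M.obj Y ⟶ U.obj Z}, H.map p ≫ c.app Z = δ.app Y ≫ p →
      H.map q ≫ c.app Z = δ.app Y ≫ q → M.η.app Y ≫ p = M.η.app Y ≫ q → p = q :=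
    fun {Y Z p q} hp hq h => free_hom_ext adj (hc Z) hp hq h
  choose p hp hη using ex
  have hδ : ∀ {Y Z : C} (g : Y ⟶ Z), H.map (M.map g) ≫ δ.app Z = δ.app Y ≫ M.map g :=
    fun g => δ.naturality g
  have hnat : ∀ {Y Z : C} (g : Y ⟶ Z), M.map g ≫ p Z = p Y ≫ U.map g := by
    intro Y Z g
    have hM : g ≫ M.η.app Z = M.η.app Y ≫ M.map g := M.η.naturality g
    have hU : g ≫ U.η.app Z = U.η.app Y ≫ U.map g := U.η.naturality g
    apply ext
    · rw [H.map_comp, Category.assoc, hp, reassoc_of% (hδ g)]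
    · rw [H.map_comp, Category.assoc, U.action_naturality, reassoc_of% (hp Y)]
    · rw [← reassoc_of% hM, hη, reassoc_of% (hη Y), hU]
  have hμ : ∀ Y, M.μ.app Y ≫ p Y = (M.map (p Y) ≫ p (U.obj Y)) ≫ U.μ.app Y := by
    intro Y
    have h : H.map (M.μ.app Y) ≫ δ.app Y = δ.app (M.obj Y) ≫ M.μ.app Y :=
      (freeIdealMonad adj).μ'_σ Y
    have hM : p Y ≫ M.η.app (U.obj Y) = M.η.app (M.obj Y) ≫ M.map (p Y) := M.η.naturality (p Y)
    apply ext (Y := M.obj Y)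
    · rw [H.map_comp, Category.assoc, hp, reassoc_of% h]
    · rw [H.map_comp, H.map_comp, Category.assoc, Category.assoc, U.action_mu,
        reassoc_of% (hp (U.obj Y)), reassoc_of% (hδ (p Y)), Category.assoc]
    · have h₁ := M.left_unit Y
      have h₂ : U.η.app (U.obj Y) ≫ U.μ.app Y = 𝟙 (U.obj Y) := U.left_unit Y
      rw [reassoc_of% h₁, Category.assoc, ← reassoc_of% hM, reassoc_of% (hη (U.obj Y)), h₂,
        Category.comp_id]
  obtain ⟨lam', hlam'⟩ := hlam
  obtain ⟨q, hδσ⟩ : ∃ q : ∀ Y, H.obj (M.obj Y) ⟶ U.ideal.obj Y,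
      ∀ Y, δ.app Y ≫ p Y = q Y ≫ U.σ.app Y := by
    refine ⟨fun Y => H.map (p Y) ≫ lam'.app (U.obj Y) ≫ U.μ'.app Y, fun Y => ?_⟩
    have h : c.app Y = _ := U.action_eq_comp_σ lam hlam' Y
    rw [← hp, h, Category.assoc, Category.assoc, Category.assoc]
  let l : (freeIdealMonad adj).toMonad ⟶ U.toMonad :=
    { app := p
      naturality := fun _ _ g => hnat g
      app_η := hη
      app_μ := hμ }
  let f : freeIdealMonad adj ⟶ U :=
    { l := l
      l' :=
        { app := q
          naturality := fun Y Z g => by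
            have := U.mono_σ Z
            change H.map (M.map g) ≫ q Z = q Y ≫ U.ideal.map g
            rw [← cancel_mono (U.σ.app Z), Category.assoc, Category.assoc, U.σ.naturality g,
              ← hδσ, ← reassoc_of% (hδσ Y), ← hnat g, reassoc_of% (hδ g)] }
      comm := by ext Y; exact hδσ Y }
  refine ⟨f, ?_, ?_⟩
  · ext Y
    change (H.map (M.η.app Y) ≫ δ.app Y) ≫ p Y = lam.app Y
    have h := U.eta_action lam Y
    rw [Category.assoc, ← hp, ← H.map_comp_assoc, hη, h]
  · intro g hg
    have hgl : ∀ Y, g.l.app Y = p Y := by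
      intro Y
      apply ext
      · have := U.action_comp_app lam (freeUnit adj) g.l hg Y
        rw [action_freeUnit] at this
        exact this.symm
      · exact hp Y
      · rw [hη]
        exact g.l.app_η Y
    have hl : g.l = f.l := by
      apply MonadHom.ext'
      funext Y
      exact hgl Y
    refine IdealMonad.Hom.ext hl ?_
    ext Y
    have := U.mono_σ Y
    rw [← cancel_mono (U.σ.app Y), ← NatTrans.comp_app, ← NatTrans.comp_app, ← g.comm, ← f.comm, hl]

end FreeAlgebraMonad

/-! ### The ideal of a free corecursive monad -/

namespace IdealMonad

variable {C : Type u} [Category.{v} C] {H : C ⥤ C} [HasBinaryCoproducts C]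
  (S : IdealMonad C) (κ : H ⟶ S.toFunctor)

/-- The morphism `[c, η] : H S Y + Y ⟶ S Y`, where `c` is the action of `κ` on `S`. -/
noncomputable def unguard (Y : C) : H.obj (S.obj Y) ⨿ Y ⟶ S.obj Y :=
  coprod.desc ((S.action κ).app Y) (S.η.app Y)

theorem inl_unguard (Y : C) :
    (coprod.inl : _ ⟶ H.obj (S.obj Y) ⨿ Y) ≫ S.unguard κ Y = (S.action κ).app Y :=
  coprod.inl_desc _ _

theorem inr_unguard (Y : C) :
    (coprod.inr : _ ⟶ H.obj (S.obj Y) ⨿ Y) ≫ S.unguard κ Y = S.η.app Y :=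
  coprod.inr_desc _ _

theorem unguard_naturality {Y Z : C} (g : Y ⟶ Z) :
    coprod.map (H.map (S.map g)) g ≫ S.unguard κ Z = S.unguard κ Y ≫ S.map g := by
  have h : g ≫ S.η.app Z = S.η.app Y ≫ S.map g := S.η.naturality g
  apply coprod.hom_ext
  · rw [coprod.inl_map_assoc, inl_unguard, reassoc_of% (S.inl_unguard κ Y), action_naturality]
  · rw [coprod.inr_map_assoc, inr_unguard, reassoc_of% (S.inr_unguard κ Y), h]

/-- The morphism `S [c, η]` followed by the multiplication of `S`; `H` applied to it is the
restricted multiplication of the monad `HS + Id`. -/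
noncomputable def substUnguard (Y : C) : S.obj (H.obj (S.obj Y) ⨿ Y) ⟶ S.obj Y :=
  S.map (S.unguard κ Y) ≫ S.μ.app Y

/-- The multiplication of the monad `HS + Id`. -/
noncomputable def guardedMul (Y : C) :
    H.obj (S.obj (H.obj (S.obj Y) ⨿ Y)) ⨿ (H.obj (S.obj Y) ⨿ Y) ⟶ H.obj (S.obj Y) ⨿ Y :=
  coprod.desc (H.map (S.substUnguard κ Y) ≫ coprod.inl) (𝟙 _)

theorem inl_guardedMul (Y : C) :
    (coprod.inl : H.obj (S.obj (H.obj (S.obj Y) ⨿ Y)) ⟶ _) ≫ S.guardedMul κ Y =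
      H.map (S.substUnguard κ Y) ≫ coprod.inl :=
  coprod.inl_desc _ _

theorem inr_guardedMul (Y : C) :
    (coprod.inr : (H.obj (S.obj Y) ⨿ Y) ⟶ _) ≫ S.guardedMul κ Y = 𝟙 _ :=
  coprod.inr_desc _ _

theorem substUnguard_naturality {Y Z : C} (g : Y ⟶ Z) :
    S.map (coprod.map (H.map (S.map g)) g) ≫ S.substUnguard κ Z =
      S.substUnguard κ Y ≫ S.map g := by
  have h : S.map (S.map g) ≫ S.μ.app Z = S.μ.app Y ≫ S.map g := S.μ.naturality g
  rw [substUnguard, substUnguard, ← S.map_comp_assoc, unguard_naturality, S.map_comp,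
    Category.assoc, Category.assoc, h]

/-- `[c, η] : HS + Id ⟶ S` preserves the multiplication. -/
theorem guardedMul_unguard (Y : C) :
    S.guardedMul κ Y ≫ S.unguard κ Y = S.unguard κ _ ≫ S.substUnguard κ Y := by
  apply coprod.hom_ext
  · rw [reassoc_of% (S.inl_guardedMul κ Y), inl_unguard,
      reassoc_of% (S.inl_unguard κ (H.obj (S.obj Y) ⨿ Y)),
      substUnguard, H.map_comp, Category.assoc, action_mu,
      reassoc_of% (S.action_naturality κ (S.unguard κ Y))]
  · have h : S.unguard κ Y ≫ S.η.app _ = S.η.app _ ≫ S.map (S.unguard κ Y) :=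
      S.η.naturality (S.unguard κ Y)
    have h' : S.η.app (S.obj Y) ≫ S.μ.app Y = 𝟙 (S.obj Y) := S.left_unit Y
    rw [reassoc_of% (S.inr_guardedMul κ Y),
      reassoc_of% (S.inr_unguard κ (H.obj (S.obj Y) ⨿ Y)), substUnguard, ← reassoc_of% h, h',
      Category.comp_id]

theorem map_guardedMul_substUnguard (Y : C) :
    S.map (S.guardedMul κ Y) ≫ S.substUnguard κ Y = S.substUnguard κ _ ≫ S.substUnguard κ Y := by
  have h₁ : S.map (S.map (S.unguard κ Y)) ≫ S.μ.app (S.obj Y) =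
      S.μ.app _ ≫ S.map (S.unguard κ Y) := S.μ.naturality (S.unguard κ Y)
  have h₂ := S.assoc Y
  conv_lhs => rw [substUnguard, ← S.map_comp_assoc, guardedMul_unguard]
  rw [S.map_comp, Category.assoc, substUnguard, S.map_comp, Category.assoc, h₂,
    reassoc_of% h₁, substUnguard, Category.assoc]

/-- The monad `HS + Id`, with ideal `HS`. -/
noncomputable def guarded [MonoCoprod C] : IdealMonad C where
  obj Y := H.obj (S.obj Y) ⨿ Y
  map g := coprod.map (H.map (S.map g)) g
  map_id Y := by simp
  map_comp f g := by simp
  η := { app := fun Y => coprod.inr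
         naturality := fun Y Z g => (coprod.inr_map _ _).symm }
  μ :=
    { app := S.guardedMul κ
      naturality := fun Y Z g => by
        change coprod.map (H.map (S.map (coprod.map (H.map (S.map g)) g)))
          (coprod.map (H.map (S.map g)) g) ≫ S.guardedMul κ Z =
            S.guardedMul κ Y ≫ coprod.map (H.map (S.map g)) g
        apply coprod.hom_ext
        · rw [coprod.inl_map_assoc, inl_guardedMul, reassoc_of% (S.inl_guardedMul κ Y),
            coprod.inl_map, ← H.map_comp_assoc, ← H.map_comp_assoc, substUnguard_naturality]
        · rw [coprod.inr_map_assoc, inr_guardedMul, reassoc_of% (S.inr_guardedMul κ Y),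
            Category.comp_id] }
  assoc Y := by
    change coprod.map (H.map (S.map (S.guardedMul κ Y))) (S.guardedMul κ Y) ≫ S.guardedMul κ Y =
      S.guardedMul κ _ ≫ S.guardedMul κ Y
    apply coprod.hom_ext
    · rw [coprod.inl_map_assoc, inl_guardedMul,
        reassoc_of% (S.inl_guardedMul κ (H.obj (S.obj Y) ⨿ Y)), inl_guardedMul,
        ← H.map_comp_assoc, ← H.map_comp_assoc, map_guardedMul_substUnguard]
    · rw [coprod.inr_map_assoc, inr_guardedMul,
        reassoc_of% (S.inr_guardedMul κ (H.obj (S.obj Y) ⨿ Y)), Category.comp_id]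
  left_unit Y := S.inr_guardedMul κ Y
  right_unit Y := by
    have h : S.map (S.η.app Y) ≫ S.μ.app Y = 𝟙 (S.obj Y) := S.right_unit Y
    have h' : H.map (S.map (S.η.app Y) ≫ S.μ.app Y) ≫
        (coprod.inl : _ ⟶ H.obj (S.obj Y) ⨿ Y) = coprod.inl := by
      have hid : H.map (𝟙 (S.obj Y)) ≫ (coprod.inl : _ ⟶ H.obj (S.obj Y) ⨿ Y) = coprod.inl := by
        rw [H.map_id, Category.id_comp]
      exact (congrArg (fun k : S.obj Y ⟶ S.obj Y => H.map k ≫ coprod.inl) h).trans hid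
    change coprod.map (H.map (S.map coprod.inr)) coprod.inr ≫ S.guardedMul κ Y = 𝟙 _
    apply coprod.hom_ext
    · rw [coprod.inl_map_assoc, inl_guardedMul, ← H.map_comp_assoc, substUnguard,
        ← S.map_comp_assoc, inr_unguard, Category.comp_id]
      exact h'
    · rw [coprod.inr_map_assoc, inr_guardedMul, Category.comp_id]
  ideal := S.toFunctor ⋙ H
  σ := { app := fun Y => coprod.inl
         naturality := fun Y Z g => (coprod.inl_map _ _).symm }
  μ' :=
    { app := fun Y => H.map (S.substUnguard κ Y)
      naturality := fun Y Z g => by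
        change H.map (S.map (coprod.map (H.map (S.map g)) g)) ≫ H.map _ = H.map _ ≫ H.map (S.map g)
        rw [← H.map_comp, substUnguard_naturality, H.map_comp] }
  mono_σ Y := by
    change Mono (coprod.inl : _ ⟶ H.obj (S.obj Y) ⨿ Y)
    infer_instance
  isCoproduct Y := ⟨coprodIsCoprod _ _⟩
  μ'_σ Y := (S.inl_guardedMul κ Y).symm

variable [MonoCoprod C]

/-- A solution in `HS + Id` of `e : X ⟶ HSX` is a solution in `S` of `c · e`, up to `[c, η]`. -/
theorem guarded_isCorecursive (hS : S.IsCorecursive) (hκ : S.IsIdealTransformation κ) :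
    (S.guarded κ).IsCorecursive := by
  obtain ⟨κ', hκ'⟩ := hκ
  intro X (e : X ⟶ H.obj (S.obj X) ⨿ X) he Y
  obtain ⟨e₀, he⟩ : ∃ e₀ : X ⟶ H.obj (S.obj X), e₀ ≫ coprod.inl = e := he
  change ∃! s : X ⟶ H.obj (S.obj Y) ⨿ Y,
    s = e ≫ coprod.map (H.map (S.map s)) s ≫ S.guardedMul κ Y
  have hsol : ∀ s : X ⟶ H.obj (S.obj Y) ⨿ Y,
      s = e ≫ coprod.map (H.map (S.map s)) s ≫ S.guardedMul κ Y ↔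
        s = e₀ ≫ H.map (S.map (s ≫ S.unguard κ Y) ≫ S.μ.app Y) ≫ coprod.inl := by
    intro s
    rw [← he, Category.assoc, coprod.inl_map_assoc, inl_guardedMul, ← H.map_comp_assoc,
      substUnguard, ← S.map_comp_assoc]
  have hc : ∀ t : X ⟶ S.obj Y, (e₀ ≫ (S.action κ).app X) ≫ S.map t ≫ S.μ.app Y =
      e₀ ≫ H.map (S.map t ≫ S.μ.app Y) ≫ (S.action κ).app Y := by
    intro t
    rw [H.map_comp, Category.assoc, Category.assoc, action_mu,
      reassoc_of% (S.action_naturality κ t)]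
  have hideal : S.IsIdealEquation (e₀ ≫ (S.action κ).app X) :=
    ⟨e₀ ≫ κ'.app (S.obj X) ≫ S.μ'.app X, by
      rw [action_eq_comp_σ S κ hκ', Category.assoc]⟩
  obtain ⟨t, ht, hu⟩ := hS X _ hideal Y
  dsimp only [IsEquationSolution] at ht hu
  rw [hc] at ht
  refine ⟨e₀ ≫ H.map (S.map t ≫ S.μ.app Y) ≫ coprod.inl, (hsol _).2 ?_, fun s hs => ?_⟩
  · have h : (e₀ ≫ H.map (S.map t ≫ S.μ.app Y) ≫ coprod.inl) ≫ S.unguard κ Y = t := by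
      rw [Category.assoc, Category.assoc, inl_unguard]
      exact ht.symm
    rw [h]
  · replace hs := (hsol s).1 hs
    have h : s ≫ S.unguard κ Y = t := by
      apply hu
      rw [hc]
      conv_lhs => rw [hs]
      rw [Category.assoc, Category.assoc, inl_unguard]
    rw [h] at hs
    exact hs

/-- `[c, η] : HS + Id ⟶ S` is a morphism of ideal monads. -/
noncomputable def unguardHom {κ' : H ⟶ S.ideal} (hκ' : κ' ≫ S.σ = κ) : S.guarded κ ⟶ S where
  l :=
    { app := S.unguard κ
      naturality := fun _ _ g => S.unguard_naturality κ g
      app_η := S.inr_unguard κ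
      app_μ := fun Y => by
        change S.guardedMul κ Y ≫ S.unguard κ Y =
          (coprod.map (H.map (S.map (S.unguard κ Y))) (S.unguard κ Y) ≫ S.unguard κ _) ≫ S.μ.app Y
        rw [guardedMul_unguard, unguard_naturality, Category.assoc, substUnguard] }
  l' := Functor.whiskerLeft S.toFunctor κ' ≫ S.μ'
  comm := by
    ext Y
    exact (S.inl_unguard κ Y).trans (S.action_eq_comp_σ κ hκ' Y)

/-- The ideal of a free corecursive monad is `HS`: by universality, the morphism `κ` lifts to
`HS + Id` and the lifting is inverse to `[c, η] : HS + Id ⟶ S`. -/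
theorem IsFreeCorecursiveMonad.isCoproduct_action {S : IdealMonad C} {κ : H ⟶ S.toFunctor}
    (hS : IsFreeCorecursiveMonad H S κ) (Y : C) :
    Nonempty (IsColimit (BinaryCofan.mk ((S.action κ).app Y) (S.η.app Y))) := by
  obtain ⟨κ', hκ'⟩ := hS.isIdeal
  let lam : H ⟶ (S.guarded κ).toFunctor := Functor.whiskerRight S.η H ≫ (S.guarded κ).σ
  obtain ⟨f, hf, -⟩ := hS.universal (S.guarded κ) (S.guarded_isCorecursive κ hS.isCorecursive
    hS.isIdeal) lam ⟨_, rfl⟩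
  have hfp : f ≫ S.unguardHom κ hκ' = 𝟙 S := by
    refine (hS.universal S hS.isCorecursive κ hS.isIdeal).unique ?_ (Category.comp_id κ)
    change κ ≫ natTrans f ≫ natTrans (S.unguardHom κ hκ') = κ
    rw [reassoc_of% hf]
    ext Y
    have h := S.eta_action κ Y
    change (H.map (S.η.app Y) ≫ coprod.inl) ≫ S.unguard κ Y = κ.app Y
    rw [Category.assoc, inl_unguard, h]
  have hfp' : ∀ Z, f.l.app Z ≫ S.unguard κ Z = 𝟙 (S.obj Z) := fun Z =>
    congrArg (fun g : S ⟶ S => g.l.app Z) hfp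
  have hη : S.η.app Y ≫ f.l.app Y = coprod.inr := f.l.app_η Y
  refine nonempty_isColimit_of_retraction _ _ (f.l.app Y) ?_ hη (hfp' Y)
  have h := action_comp_app _ lam κ f.l hf Y
  have h' : ((S.guarded κ).action lam).app Y =
      H.map (S.unguard κ Y) ≫ coprod.inl := by
    have h₁ : S.unguard κ Y ≫ S.η.app _ = S.η.app _ ≫ S.map (S.unguard κ Y) :=
      S.η.naturality (S.unguard κ Y)
    have h₂ : S.η.app (S.obj Y) ≫ S.μ.app Y = 𝟙 (S.obj Y) := S.left_unit Y
    change (H.map (S.η.app _) ≫ coprod.inl) ≫ S.guardedMul κ Y = _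
    rw [Category.assoc, inl_guardedMul, ← H.map_comp_assoc, substUnguard, ← reassoc_of% h₁, h₂,
      Category.comp_id]
  refine h.trans ?_
  let g : S.obj Y ⟶ H.obj (S.obj Y) ⨿ Y := f.l.app Y
  have hg : g ≫ S.unguard κ Y = 𝟙 (S.obj Y) := hfp' Y
  have hid : H.map g ≫ H.map (S.unguard κ Y) ≫
      (coprod.inl : _ ⟶ H.obj (S.obj Y) ⨿ Y) = coprod.inl := by
    rw [← H.map_comp_assoc, hg, H.map_id, Category.id_comp]
  exact (congrArg (H.map g ≫ ·) h').trans hid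

end IdealMonad

/-! ### Subalgebras of algebras for a set functor -/

section Subalgebras

/-- The inclusion of a subset, as a morphism of `Type`. -/
abbrev incl {X : Type w} (N : Set X) : (N : Type w) ⟶ X :=
  TypeCat.ofHom Subtype.val

/-- The corestriction of a map to a subset containing its values. -/
abbrev corestrict {X Z : Type w} {N : Set Z} (f : X ⟶ Z) (hf : ∀ x, f x ∈ N) :
    X ⟶ (N : Type w) :=
  TypeCat.ofHom fun x => ⟨f x, hf x⟩

theorem corestrict_incl {X Z : Type w} {N : Set Z} (f : X ⟶ Z) (hf : ∀ x, f x ∈ N) :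
    corestrict f hf ≫ incl N = f := rfl

variable {H : Type w ⥤ Type w}

/-- A subset `N` of an algebra `P` is a subalgebra if the structure of `P` maps the image of `H N`
into `N`. The map `H N ⟶ H P` need not be injective. -/
def IsSubalgebra (P : Endofunctor.Algebra H) (N : Set P.a) : Prop :=
  ∀ z : H.obj N, P.str (H.map (incl N) z) ∈ N

/-- The structure of the algebra on a subalgebra. -/
def IsSubalgebra.algebra {P : Endofunctor.Algebra H} {N : Set P.a} (hN : IsSubalgebra P N) :
    Endofunctor.Algebra H where
  a := N
  str := TypeCat.ofHom fun z => ⟨P.str (H.map (incl N) z), hN z⟩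

/-- The inclusion of a subalgebra. -/
def IsSubalgebra.inclHom {P : Endofunctor.Algebra H} {N : Set P.a} (hN : IsSubalgebra P N) :
    hN.algebra ⟶ P where
  f := incl N
  h := rfl

theorem map_incl_of_factor (P : Endofunctor.Algebra H) {N : Set P.a} {X : Type w} (f : X ⟶ P.a)
    (hf : ∀ x, f x ∈ N) (z : H.obj X) :
    P.str (H.map (incl N) (H.map (corestrict f hf) z)) = P.str (H.map f z) := by
  rw [← Functor.map_comp_apply, corestrict_incl]

theorem IsSubalgebra.apply_mem {P : Endofunctor.Algebra H} {N : Set P.a} (hN : IsSubalgebra P N)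
    {X : Type w} (f : X ⟶ P.a) (hf : ∀ x, f x ∈ N) (z : H.obj X) : P.str (H.map f z) ∈ N := by
  rw [← map_incl_of_factor P f hf]
  exact hN _

/-- The least subalgebra containing a given subset. -/
def subalgebraClosure (P : Endofunctor.Algebra H) (G : Set P.a) : Set P.a :=
  ⋂₀ {N | IsSubalgebra P N ∧ G ⊆ N}

theorem subset_subalgebraClosure (P : Endofunctor.Algebra H) (G : Set P.a) :
    G ⊆ subalgebraClosure P G :=
  Set.subset_sInter fun _ hN => hN.2

theorem subalgebraClosure_subset {P : Endofunctor.Algebra H} {G N : Set P.a}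
    (hN : IsSubalgebra P N) (hG : G ⊆ N) : subalgebraClosure P G ⊆ N :=
  Set.sInter_subset_of_mem ⟨hN, hG⟩

theorem isSubalgebra_closure (P : Endofunctor.Algebra H) (G : Set P.a) :
    IsSubalgebra P (subalgebraClosure P G) :=
  fun z => Set.mem_sInter.2 fun _ hN =>
    hN.1.apply_mem (incl _) (fun x => subalgebraClosure_subset hN.1 hN.2 x.2) z

/-- The image of a subalgebra under a homomorphism is a subalgebra. -/
theorem IsSubalgebra.image {P B : Endofunctor.Algebra H} (π : P ⟶ B) {R : Set P.a}
    (hR : IsSubalgebra P R) : IsSubalgebra B (π.f '' R) := by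
  intro z
  choose r hr hrπ using fun x : π.f '' R => x.2
  let ρ : ((π.f '' R : Set B.a) : Type w) ⟶ P.a := TypeCat.ofHom r
  have hρ : ρ ≫ π.f = incl _ := by
    ext x
    exact hrπ x
  refine ⟨P.str (H.map ρ z), hR.apply_mem ρ hr z, ?_⟩
  rw [← hρ, Functor.map_comp_apply]
  exact (types_congr_hom π.h (H.map ρ z)).symm

/-- The elements on which two homomorphisms defined on a subalgebra agree form a subalgebra. -/
theorem isSubalgebra_eq {P A : Endofunctor.Algebra H} {N : Set P.a} (hN : IsSubalgebra P N)
    (g g' : hN.algebra ⟶ A) :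
    IsSubalgebra P {x | ∃ h : x ∈ N, g.f (⟨x, h⟩ : N) = g'.f (⟨x, h⟩ : N)} := by
  let D : Set P.a := {x | ∃ h : x ∈ N, g.f (⟨x, h⟩ : N) = g'.f (⟨x, h⟩ : N)}
  intro (z : H.obj D)
  have hD : ∀ x : D, incl D x ∈ N := fun x => x.2.1
  let j : (D : Type w) ⟶ hN.algebra.a := corestrict (incl D) hD
  have hj : j ≫ g.f = j ≫ g'.f := by
    ext x
    exact x.2.2
  have hval : ∀ k : hN.algebra ⟶ A, k.f (hN.algebra.str (H.map j z)) =
      A.str (H.map (j ≫ k.f) z) := by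
    intro k
    rw [Functor.map_comp_apply]
    exact (types_congr_hom k.h (H.map j z)).symm
  have hstr : hN.algebra.str (H.map j z) =
      (⟨P.str (H.map (incl D) z), hN.apply_mem _ hD z⟩ : N) :=
    Subtype.ext (map_incl_of_factor P (incl D) hD z)
  refine ⟨hN.apply_mem _ hD z, ?_⟩
  rw [← hstr, hval g, hval g', hj]

/-- The product of two algebras. -/
def prodAlgebra (A B : Endofunctor.Algebra H) : Endofunctor.Algebra H where
  a := A.a × B.a
  str := TypeCat.ofHom fun z =>
    (A.str (H.map (TypeCat.ofHom Prod.fst) z), B.str (H.map (TypeCat.ofHom Prod.snd) z))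

/-- The first projection of a product of algebras. -/
def prodFst (A B : Endofunctor.Algebra H) : prodAlgebra A B ⟶ A where
  f := TypeCat.ofHom Prod.fst
  h := rfl

/-- The second projection of a product of algebras. -/
def prodSnd (A B : Endofunctor.Algebra H) : prodAlgebra A B ⟶ B where
  f := TypeCat.ofHom Prod.snd
  h := rfl

/-- The homomorphism into a product of algebras with given components. -/
def prodLift {T A B : Endofunctor.Algebra H} (f : T ⟶ A) (g : T ⟶ B) : T ⟶ prodAlgebra A B where
  f := TypeCat.ofHom fun x => (f.f x, g.f x)
  h := by
    let k : T.a ⟶ (A.a × B.a : Type w) := TypeCat.ofHom fun x => (f.f x, g.f x)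
    ext z
    apply Prod.ext
    · exact (congrArg A.str (H.map_comp_apply k (TypeCat.ofHom Prod.fst) z).symm).trans
        (types_congr_hom f.h z)
    · exact (congrArg B.str (H.map_comp_apply k (TypeCat.ofHom Prod.snd) z).symm).trans
        (types_congr_hom g.h z)

end Subalgebras

/-! ### Subalgebras on which a homomorphism is injective -/

section Postfixed

variable {H : Type w ⥤ Type w}

/-- One step in the generation of a subalgebra of `P` by the values of `p : Y ⟶ P`. -/
def genStep (P : Endofunctor.Algebra H) {Y : Type w} (p : Y → P.a) (R : Set P.a) : Set P.a :=
  Set.range p ∪ Set.range fun z : H.obj R => P.str (H.map (incl R) z)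

theorem genStep_mono (P : Endofunctor.Algebra H) {Y : Type w} (p : Y → P.a) {R R' : Set P.a}
    (h : R ⊆ R') : genStep P p R ⊆ genStep P p R' := by
  apply Set.union_subset_union_right
  rintro _ ⟨z, rfl⟩
  exact ⟨H.map (corestrict (incl R) fun x => h x.2) z, map_incl_of_factor P (incl R) _ z⟩

theorem range_subset_genStep {T P : Endofunctor.Algebra H} (hT : Function.Surjective T.str)
    (q : T ⟶ P) {Y : Type w} (p : Y → P.a) :
    Set.range q.f ⊆ genStep P p (Set.range q.f) := by
  rintro _ ⟨x, rfl⟩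
  obtain ⟨z, rfl⟩ := hT x
  refine Or.inr ⟨H.map (corestrict q.f fun x => Set.mem_range_self x) z, ?_⟩
  exact (map_incl_of_factor P q.f _ z).trans (types_congr_hom q.h z)

theorem map_injective_of_nonempty {X Z : Type w} [Nonempty X] {f : X ⟶ Z}
    (hf : Function.Injective f) : Function.Injective (H.map f) := by
  let r : Z ⟶ X := TypeCat.ofHom (Function.invFun f)
  have hr : f ≫ r = 𝟙 X := by
    ext x
    exact Function.leftInverse_invFun hf x
  intro z z' h
  have := congrArg (H.map r) h
  rwa [← Functor.map_comp_apply, ← Functor.map_comp_apply, hr,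
    Functor.map_id_apply, Functor.map_id_apply] at this

/-- An injection `f : X ⟶ Z` with `X` nonempty splits, and so it is preserved by `H`. The hypothesis
`hT` makes `H X` empty when `X` is empty. -/
theorem map_injective {X Z T : Type w} (k : T → X) (hT : IsEmpty T → IsEmpty (H.obj T))
    {f : X ⟶ Z} (hf : Function.Injective f) : Function.Injective (H.map f) := by
  rcases isEmpty_or_nonempty X with hX | hX
  · have hE := hT ⟨fun x => hX.false (k x)⟩
    intro z
    exact (hE.false (H.map (TypeCat.ofHom fun x => hX.elim x) z)).elim
  · exact map_injective_of_nonempty hf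

/-- A maximal set `R` that is postfixed for `genStep` and on which `π` is injective is a
subalgebra: since the structure of `B` and `η` are injective with disjoint ranges, `π` remains
injective on `genStep P p R`. -/
theorem exists_subalgebra_injOn {P B : Endofunctor.Algebra H} (π : P ⟶ B) {Y : Type w}
    (p : Y → P.a) (η : Y → B.a) (hp : ∀ y, π.f (p y) = η y) (hη : Function.Injective η)
    (hB : Function.Injective B.str) (hBη : ∀ z y, B.str z ≠ η y) {R₀ : Set P.a}
    (hR₀ : R₀ ⊆ genStep P p R₀) (hinj : Set.InjOn π.f R₀)
    (hH : ∀ R, R₀ ⊆ R → Set.InjOn π.f R → Function.Injective (H.map (incl R ≫ π.f))) :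
    ∃ R, R₀ ⊆ R ∧ Set.InjOn π.f R ∧ IsSubalgebra P R ∧ Set.range p ⊆ R := by
  obtain ⟨R, hR, hmax⟩ := zorn_subset_nonempty
    {R : Set P.a | R₀ ⊆ R ∧ Set.InjOn π.f R ∧ R ⊆ genStep P p R} (by
      rintro 𝒞 h𝒞 hchain ⟨R₁, hR₁⟩
      refine ⟨⋃₀ 𝒞, ⟨(h𝒞 hR₁).1.trans (Set.subset_sUnion_of_mem hR₁), ?_, ?_⟩,
        fun R hR => Set.subset_sUnion_of_mem hR⟩
      · rintro x ⟨R, hR, hx⟩ x' ⟨R', hR', hx'⟩ h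
        obtain ⟨R'', hR'', h₁, h₂⟩ := hchain.directedOn R hR R' hR'
        exact (h𝒞 hR'').2.1 (h₁ hx) (h₂ hx') h
      · rintro x ⟨R, hR, hx⟩
        exact genStep_mono P p (Set.subset_sUnion_of_mem hR) ((h𝒞 hR).2.2 hx))
    R₀ ⟨subset_rfl, hinj, hR₀⟩
  obtain ⟨-, hRinj, hRpost⟩ := hmax.prop
  have hπ : ∀ z : H.obj R, π.f (P.str (H.map (incl R) z)) = B.str (H.map (incl R ≫ π.f) z) := by
    intro z
    rw [Functor.map_comp_apply]
    exact (types_congr_hom π.h _).symm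
  have hstep : Set.InjOn π.f (genStep P p R) := by
    rintro _ (⟨y, rfl⟩ | ⟨z, rfl⟩) _ (⟨y', rfl⟩ | ⟨z', rfl⟩) h
    · rw [hp, hp] at h
      rw [hη h]
    -- a value of `η` is not a value of the structure of `B`
    · dsimp only at h
      rw [hp, hπ] at h
      exact (hBη _ _ h.symm).elim
    · dsimp only at h
      rw [hp, hπ] at h
      exact (hBη _ _ h).elim
    · dsimp only at h
      rw [hπ, hπ] at h
      rw [hH R hR hRinj (hB h)]
  have hfix : genStep P p R ⊆ R :=
    hmax.le_of_ge ⟨hR.trans hRpost, hstep, genStep_mono P p hRpost⟩ hRpost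
  exact ⟨R, hR, hRinj, fun z => hfix (Or.inr ⟨z, rfl⟩), fun x hx => hfix (Or.inl hx)⟩

end Postfixed

/-! ### Free corecursive algebras inside corecursive algebras -/

section FreeSubalgebra

variable {H : Type w ⥤ Type w}

/-- The homomorphisms from `T` are the solutions of the coalgebra given by the inverse of its
structure. -/
theorem IsCorecursiveAlgebra.hom_ext {T A : Endofunctor.Algebra H} [IsIso T.str]
    (hA : IsCorecursiveAlgebra H A) (g g' : T ⟶ A) : g.f = g'.f := by
  refine (hA ⟨T.a, inv T.str⟩).unique ?_ ?_
  · change g.f = inv T.str ≫ H.map g.f ≫ A.str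
    rw [g.h, IsIso.inv_hom_id_assoc]
  · change g'.f = inv T.str ≫ H.map g'.f ≫ A.str
    rw [g'.h, IsIso.inv_hom_id_assoc]

theorem IsCorecursiveAlgebra.exists_hom (T : Endofunctor.Algebra H) [IsIso T.str]
    {A : Endofunctor.Algebra H} (hA : IsCorecursiveAlgebra H A) : Nonempty (T ⟶ A) := by
  obtain ⟨g, hg, -⟩ := hA ⟨T.a, inv T.str⟩
  replace hg : g = inv T.str ≫ H.map g ≫ A.str := hg
  refine ⟨⟨g, ?_⟩⟩
  conv_rhs => rw [hg]
  rw [IsIso.hom_inv_id_assoc]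

theorem IsSolution.comp_hom {E : Endofunctor.Coalgebra H} {A B : Endofunctor.Algebra H}
    {s : E.V ⟶ A.a} (hs : IsSolution E A s) (g : A ⟶ B) : IsSolution E B (s ≫ g.f) := by
  change s ≫ g.f = E.str ≫ H.map (s ≫ g.f) ≫ B.str
  conv_lhs => rw [show s = E.str ≫ H.map s ≫ A.str from hs]
  rw [H.map_comp, Category.assoc, Category.assoc, Category.assoc, g.h]

/-- A subalgebra of a corecursive algebra is corecursive if it contains the solutions, for which
it is enough that it receives a homomorphism from a corecursive algebra. -/
theorem IsSubalgebra.isCorecursive {T B : Endofunctor.Algebra H} (hT : IsCorecursiveAlgebra H T)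
    (hB : IsCorecursiveAlgebra H B) {N : Set B.a} (hN : IsSubalgebra B N)
    (t : T ⟶ hN.algebra) : IsCorecursiveAlgebra H hN.algebra := by
  intro E
  obtain ⟨s, hs, -⟩ := hT E
  refine ⟨s ≫ t.f, hs.comp_hom t, fun m hm => ?_⟩
  have h := (hB E).unique (IsSolution.comp_hom hm hN.inclHom)
    ((hs.comp_hom t).comp_hom hN.inclHom)
  ext x
  exact Subtype.ext (types_congr_hom h x)

/-- If the structure of a corecursive algebra `B` and `η : Y ⟶ B` are injective with disjoint
ranges, and `t : T ⟶ B` is an injective homomorphism from a corecursive algebra with invertible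
structure (equivalently, from the terminal coalgebra), then the subalgebra generated by the ranges
of `η` and `t` is a free corecursive algebra on `Y`. A homomorphism into `A` is obtained as a
subalgebra of `B × A` that is functional by `exists_subalgebra_injOn`. -/
theorem hasInitial_structuredArrow {B T : Endofunctor.Algebra H} (hB : IsCorecursiveAlgebra H B)
    (hT : IsCorecursiveAlgebra H T) [hTi : IsIso T.str] (t : T ⟶ B)
    (ht : Function.Injective t.f) {Y : Type w} (η : Y ⟶ B.a) (hη : Function.Injective η)
    (hBi : Function.Injective B.str) (hBη : ∀ z y, B.str z ≠ η y) :
    HasInitial (StructuredArrow Y (forgetCorecursive H)) := by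
  let N : Set B.a := subalgebraClosure B (Set.range η ∪ Set.range t.f)
  have hN : IsSubalgebra B N := isSubalgebra_closure _ _
  have hηN : ∀ y, η y ∈ N := fun y => subset_subalgebraClosure _ _ (Or.inl ⟨y, rfl⟩)
  have htN : ∀ x, t.f x ∈ N := fun x => subset_subalgebraClosure _ _ (Or.inr ⟨x, rfl⟩)
  let tN : T ⟶ hN.algebra :=
    { f := corestrict t.f htN
      h := by
        ext z
        exact Subtype.ext ((map_incl_of_factor B t.f htN z).trans (types_congr_hom t.h z)) }
  let M : CorecursiveAlgebra H := ⟨hN.algebra, hN.isCorecursive hT hB tN⟩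
  let ηN : Y ⟶ hN.algebra.a := corestrict η hηN
  have huniq : ∀ {A : Endofunctor.Algebra H}, IsCorecursiveAlgebra H A →
      ∀ g g' : hN.algebra ⟶ A, ηN ≫ g.f = ηN ≫ g'.f → g = g' := by
    intro A hA g g' h
    have hsub := subalgebraClosure_subset (G := Set.range η ∪ Set.range t.f)
      (isSubalgebra_eq hN g g') (by
        rintro _ (⟨y, rfl⟩ | ⟨x, rfl⟩)
        · exact ⟨hηN y, types_congr_hom h y⟩
        · exact ⟨htN x, types_congr_hom (hA.hom_ext (tN ≫ g) (tN ≫ g')) x⟩)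
    apply Endofunctor.Algebra.ext
    ext x
    exact (hsub x.2).2
  have hex : ∀ {A : Endofunctor.Algebra H}, IsCorecursiveAlgebra H A →
      ∀ f : Y ⟶ A.a, ∃ g : hN.algebra ⟶ A, ηN ≫ g.f = f := by
    intro A hA f
    obtain ⟨tA⟩ := hA.exists_hom T
    have hTs : Function.Bijective T.str := (isIso_iff_bijective T.str).1 hTi
    -- the graph of the prescribed values on `T` is the range of `q`
    let q : T ⟶ prodAlgebra B A := prodLift t tA
    let π : prodAlgebra B A ⟶ B := prodFst B A
    obtain ⟨R, hqR, hRinj, hR, hpR⟩ := exists_subalgebra_injOn π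
      (fun y => ((η y, f y) : B.a × A.a)) η (fun _ => rfl) hη hBi hBη
      (range_subset_genStep hTs.2 q _) (by
        rintro _ ⟨x, rfl⟩ _ ⟨x', rfl⟩ h
        rw [ht h])
      (fun R hqR hRinj => map_injective (fun x : T.a => (⟨q.f x, hqR ⟨x, rfl⟩⟩ : R))
        (fun hE => ⟨fun z => hE.false (T.str z)⟩) fun x x' h => Subtype.ext (hRinj x.2 x'.2 h))
    have hNR : N ⊆ π.f '' R := by
      apply subalgebraClosure_subset (hR.image π)
      rintro _ (⟨y, rfl⟩ | ⟨x, rfl⟩)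
      · exact ⟨_, hpR ⟨y, rfl⟩, rfl⟩
      · exact ⟨_, hqR ⟨x, rfl⟩, rfl⟩
    -- `π` is bijective from a part of `R` to `N`, and its inverse `r` is a homomorphism
    choose r hr hrπ using fun x : N => hNR x.2
    let ρ : (N : Type w) ⟶ (prodAlgebra B A).a := TypeCat.ofHom r
    have hρ : ρ ≫ π.f = incl N := by
      ext x
      exact hrπ x
    have hρh : H.map ρ ≫ (prodAlgebra B A).str = hN.algebra.str ≫ ρ := by
      ext z
      refine hRinj (hR.apply_mem ρ hr z) (hr _) ?_
      refine (types_congr_hom π.h (H.map ρ z)).symm.trans (Eq.trans ?_ (hrπ _).symm)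
      change B.str (H.map π.f (H.map ρ z)) = B.str (H.map (incl N) z)
      rw [← Functor.map_comp_apply, hρ]
    let ρh : hN.algebra ⟶ prodAlgebra B A := { f := ρ, h := hρh }
    refine ⟨ρh ≫ prodSnd B A, ?_⟩
    ext y
    have : r ⟨η y, hηN y⟩ = ((η y, f y) : B.a × A.a) :=
      hRinj (hr _) (hpR ⟨y, rfl⟩) (hrπ _)
    exact congrArg Prod.snd this
  let I : StructuredArrow Y (forgetCorecursive H) := StructuredArrow.mk (Y := M) ηN
  refine IsInitial.hasInitial (X := I) (IsInitial.ofUniqueHom (fun Z => ?_) fun Z m => ?_)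
  · exact StructuredArrow.homMk (ObjectProperty.homMk (hex Z.right.property Z.hom).choose)
      (hex Z.right.property Z.hom).choose_spec
  · apply StructuredArrow.ext
    apply ObjectProperty.hom_ext
    exact huniq Z.right.property _ _
      ((StructuredArrow.w m).trans (hex Z.right.property Z.hom).choose_spec.symm)

end FreeSubalgebra

/-! ### Existence of free corecursive algebras -/

/-- The value `S ∅` of a free corecursive monad has invertible structure, and `S ∅ ⟶ S Y` is
injective: a point of `S ∅` gives a map `Y ⟶ S ∅`, whose extension to `S Y` is a retraction. -/
theorem IdealMonad.IsFreeCorecursiveMonad.hasFreeCorecursiveAlgebras {H : Type w ⥤ Type w}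
    {S : IdealMonad (Type w)} {κ : H ⟶ S.toFunctor}
    (hS : IdealMonad.IsFreeCorecursiveMonad H S κ) : HasFreeCorecursiveAlgebras H := by
  have hcorec : ∀ Y, IsCorecursiveAlgebra H (S.actionAlgebra κ Y) :=
    S.isCorecursiveAlgebra_action κ hS.isCorecursive hS.isIdeal
  have hcop : ∀ Y, Function.Injective ((S.action κ).app Y) ∧ Function.Injective (S.η.app Y) ∧
      IsCompl (Set.range ((S.action κ).app Y)) (Set.range (S.η.app Y)) := fun Y =>
    (Types.binaryCofan_isColimit_iff _).1 (hS.isCoproduct_action Y)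
  let T : Endofunctor.Algebra H := S.actionAlgebra κ PEmpty
  have hT : IsIso T.str := by
    rw [isIso_iff_bijective]
    refine ⟨(hcop PEmpty).1, fun x => ?_⟩
    have h := (hcop PEmpty).2.2.sup_eq_top
    rcases (h.ge (Set.mem_univ x) : _ ∨ _) with hx | ⟨y, -⟩
    · exact hx
    · exact y.elim
  have init : ∀ Y, HasInitial (StructuredArrow Y (forgetCorecursive H)) := by
    intro Y
    let B : Endofunctor.Algebra H := S.actionAlgebra κ Y
    let t : T ⟶ B :=
      { f := S.map (TypeCat.ofHom PEmpty.elim)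
        h := S.action_naturality κ _ }
    have ht : Function.Injective t.f := by
      intro x x' h
      let g : B ⟶ T := S.extendHom κ (TypeCat.ofHom fun _ => x)
      have hg : t.f ≫ g.f = 𝟙 T.a := (hcorec PEmpty).hom_ext (t ≫ g) (𝟙 T)
      have := congrArg g.f h
      rwa [← types_comp_apply t.f g.f, ← types_comp_apply t.f g.f, hg] at this
    exact hasInitial_structuredArrow (hcorec Y) (hcorec PEmpty) t ht (S.η.app Y) (hcop Y).2.1
      (hcop Y).1 fun z y h => Set.disjoint_left.1 (hcop Y).2.2.disjoint ⟨z, rfl⟩ ⟨y, h.symm⟩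
  exact isRightAdjointOfStructuredArrowInitials _

end CorecursiveMonads

theorem mainTheorem10 (H : Type w ⥤ Type w)
    (S : CorecursiveMonads.IdealMonad (Type w)) (κ : H ⟶ S.toFunctor)
    (hS : CorecursiveMonads.IdealMonad.IsFreeCorecursiveMonad H S κ) :
    CorecursiveMonads.HasFreeCorecursiveAlgebras H ∧
      ∀ (F : Type w ⥤ CorecursiveMonads.CorecursiveAlgebra H)
        (adj : F ⊣ CorecursiveMonads.forgetCorecursive H),
        CorecursiveMonads.IdealMonad.IsFreeCorecursiveMonad H
            (CorecursiveMonads.freeIdealMonad adj) (CorecursiveMonads.freeUnit adj) ∧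
          ∃ i : S ≅ CorecursiveMonads.freeIdealMonad adj,
            κ ≫ CorecursiveMonads.IdealMonad.natTrans i.hom = CorecursiveMonads.freeUnit adj :=
  ⟨hS.hasFreeCorecursiveAlgebras, fun _ adj =>
    ⟨CorecursiveMonads.free_isFreeCorecursiveMonad adj,
      hS.exists_iso (CorecursiveMonads.free_isFreeCorecursiveMonad adj)⟩⟩
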